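/- Let $K$ be a field of characteristic zero, let $X$ be a set, and let $K\langle X\rangle$ be the free associative unital $K$-algebra on $X$. For a $K$-algebra $A$ and $f\in K\langle X\rangle$, let $f(A)\subseteq A$ be the set of all values of $f$ under substitutions of elements of $A$ for the variables, and let $Id(A)=\{f\in K\langle X\rangle : f(A)=\{0\}\}$. A T-ideal of $K\langle X\rangle$ is a two-sided ideal invariant under all $K$-algebra endomorphisms of $K\langle X\rangle$; the T-ideal generated by a set is the smallest T-ideal containing it. Write $[a,b]=ab-ba$. For an integer $n\ge 0$ let $UT_n=UT_n(K)$ be the algebra of upper triangular $n\times n$ matrices over $K$ ($UT_0=0$), let $J$ be its Jacobson radical, and set $J^0=UT_n$. For an integer $r\ge 0$ put \[I^r(UT_n)=\{f\in K\langle X\rangle : f(UT_n)\subseteq J^r\}.\] Then $I^r(UT_n)$ is a T-ideal of $K\langle X\rangle$. Moreover, if $0\le r\le n$, then $I^r(UT_n)=Id(UT_r)$, and for any pairwise distinct variables $x_1,\dots,x_{2r}\in X$ it is generated as a T-ideal by the polynomial $[x_1,x_2][x_3,x_4]\cdots[x_{2r-1},x_{2r}]$ (the empty product $1$ if $r=0$).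 -/

import Mathlib

/-- The algebra `UT_n(K)` of upper triangular `n × n` matrices over `K`. -/
abbrev UT (K : Type*) [Field K] (n : ℕ) : Subalgebra K (Matrix (Fin n) (Fin n) K) :=
  Matrix.blockTriangularSubalgebra K K (id : Fin n → Fin n)

/-- The image `f(A)` of a polynomial `f ∈ K⟨X⟩` on the `K`-algebra `A`: the set of all values of `f`
under substitutions of elements of `A` for the variables. -/
def polyImage {K X : Type*} [Field K] (f : FreeAlgebra K X) (A : Type*) [Ring A] [Algebra K A] :
    Set A :=
  Set.range fun a : X → A => FreeAlgebra.lift K a f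

/-- The set `Id(A) ⊆ K⟨X⟩` of polynomial identities of the `K`-algebra `A`. -/
def polyIdentities (K X : Type*) [Field K] (A : Type*) [Ring A] [Algebra K A] :
    Set (FreeAlgebra K X) :=
  {f | ∀ a : X → A, FreeAlgebra.lift K a f = 0}

/-- The set `I^r(UT_n)` of all polynomials whose image on `UT_n(K)` is contained in `J^r`, the
`r`-th power of the Jacobson radical of `UT_n(K)`; here `J^0 = UT_n(K)`. -/
def imageInRadicalPow (K X : Type*) [Field K] (n r : ℕ) : Set (FreeAlgebra K X) :=
  {f | polyImage f (UT K n) ⊆ ((Ring.jacobson (UT K n) ^ r : Ideal (UT K n)) : Set (UT K n))}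

/-- A T-ideal of `K⟨X⟩`: a two-sided ideal that is invariant under all algebra endomorphisms. -/
def IsTIdeal {K X : Type*} [Field K] (S : Set (FreeAlgebra K X)) : Prop :=
  (∃ I : TwoSidedIdeal (FreeAlgebra K X), (I : Set (FreeAlgebra K X)) = S) ∧
    ∀ φ : FreeAlgebra K X →ₐ[K] FreeAlgebra K X, ∀ f ∈ S, φ f ∈ S

/-- `S` is the T-ideal generated by `F`, the smallest T-ideal that contains `F`. -/
def IsTIdealGeneratedBy {K X : Type*} [Field K] (S F : Set (FreeAlgebra K X)) : Prop :=
  IsLeast {T : Set (FreeAlgebra K X) | IsTIdeal T ∧ F ⊆ T} S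

/-- The polynomial `[x_1, x_2] [x_3, x_4] ⋯ [x_{2r-1}, x_{2r}]`, with the variables `x` indexed
from `0`. It is `1` for `r = 0`. -/
def commutatorProduct (K : Type*) {X : Type*} [Field K] (r : ℕ) (x : Fin (2 * r) → X) :
    FreeAlgebra K X :=
  (List.ofFn fun i : Fin r =>
    ⁅FreeAlgebra.ι K (x ⟨2 * (i : ℕ), by omega⟩),
      FreeAlgebra.ι K (x ⟨2 * (i : ℕ) + 1, by omega⟩)⁆).prod

/-! Let `C_r` be the two-sided ideal generated by all products of `r` commutators of arbitrary
elements. Everything follows from `C_r ⊆ I^r(UT_n) ⊆ Id(UT_r) ⊆ C_r`, where the last two inclusions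
use `r ≤ n` and that `K` is infinite, respectively. The first holds because `J^r` consists of the
matrices vanishing on the first `r` diagonals (`UT.jacobson_pow_eq_band`) and commutators lie in
`J`. The second compares `UT_r` with the top left corner of `UT_n`, where `J^r` vanishes. The third,
`polyIdentities_UT_le_commutatorIdeal`, is a Lewin-type induction on `r`. A polynomial `f` with zero
commutative image is a sum of terms `e * v`, with each `e` a fixed element of the commutator ideal
(`FreeAlgebra.exists_expansion`). On matrices with diagonal blocks `b` (scalar) and `a`, the first
row of `f` is a polynomial in `b` whose coefficients are the rows `c_x * v(a)`. If `f` vanishes on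
`UT_{r+1}`, every `v` vanishes on `UT_r`, so `v ∈ C_r` and `e * v ∈ C_{r+1}`. -/

/-! ### Powers of the Jacobson radical of `UT_n` -/

section Radical

variable {K : Type*} [Field K] {n : ℕ}

/-- The `(i, i)` entry as an algebra homomorphism on upper triangular matrices. -/
def UT.diagHom (i : Fin n) : UT K n →ₐ[K] K where
  toFun A := A.1 i i
  map_one' := by simp
  map_zero' := by simp
  map_add' A B := by simp
  map_mul' A B := by
    simp only [MulMemClass.coe_mul, Matrix.mul_apply]
    refine Finset.sum_eq_single i (fun j _ hj => ?_) (by simp)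
    rcases lt_or_gt_of_ne hj with h | h
    · rw [A.2 h, zero_mul]
    · rw [B.2 h, mul_zero]
  commutes' k := by simp [Matrix.algebraMap_matrix_apply]

/-- The matrices in `UT_n` whose entries vanish on the first `r` diagonals. -/
def UT.band (K : Type*) [Field K] (n r : ℕ) : Ideal (UT K n) where
  carrier := {A | ∀ i j : Fin n, (j : ℕ) < i + r → A.1 i j = 0}
  zero_mem' i j _ := by simp
  add_mem' {A B} hA hB i j h := by simp [hA i j h, hB i j h]
  smul_mem' A B hB i j h := by
    simp only [smul_eq_mul, MulMemClass.coe_mul, Matrix.mul_apply]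
    refine Finset.sum_eq_zero fun k _ => ?_
    rcases lt_or_ge k i with hk | hk
    · rw [A.2 hk, zero_mul]
    · rw [hB k j (by have : (i : ℕ) ≤ k := hk; omega), mul_zero]

theorem UT.band_zero : UT.band K n 0 = ⊤ :=
  eq_top_iff.2 fun A _ _ _ h => A.2 (by simpa using h)

theorem UT.mul_mem_band {r s : ℕ} {A B : UT K n} (hA : A ∈ UT.band K n r)
    (hB : B ∈ UT.band K n s) : A * B ∈ UT.band K n (r + s) := by
  intro i j h
  simp only [MulMemClass.coe_mul, Matrix.mul_apply]
  refine Finset.sum_eq_zero fun k _ => ?_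
  rcases lt_or_ge (k : ℕ) (i + r) with hk | hk
  · rw [hA i k hk, zero_mul]
  · rw [hB k j (by omega), mul_zero]

theorem UT.pow_mem_band {A : UT K n} (hA : A ∈ UT.band K n 1) (k : ℕ) :
    A ^ k ∈ UT.band K n k := by
  induction k with
  | zero => rw [UT.band_zero]; trivial
  | succ k ih => rw [pow_succ]; exact UT.mul_mem_band ih hA

theorem UT.isNilpotent_of_mem_band {A : UT K n} (hA : A ∈ UT.band K n 1) : IsNilpotent A :=
  ⟨n, Subtype.ext <| Matrix.ext fun i j => UT.pow_mem_band hA n i j (by omega)⟩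

theorem UT.jacobson_eq_band : Ring.jacobson (UT K n) = UT.band K n 1 := by
  rw [← Ideal.jacobson_bot]
  ext A
  rw [Ideal.mem_jacobson_iff]
  constructor
  · intro h i j hij
    rcases lt_or_eq_of_le (show j ≤ i by rw [Fin.le_def]; omega) with h' | rfl
    · exact A.2 h'
    · by_contra hne
      -- This multiplier makes `1 + y * A` vanish at the diagonal entry `j`, so it has no left
      -- inverse.
      obtain ⟨z, hz⟩ := h (algebraMap K _ (-(A.1 j j)⁻¹))
      have := congrArg (UT.diagHom j) (Ideal.mem_bot.1 hz)
      rw [map_sub, map_add, map_mul, map_mul, AlgHom.commutes, map_one, map_zero] at this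
      have h2 : UT.diagHom j A = A.1 j j := rfl
      rw [h2] at this
      simp [hne] at this
  · intro hA y
    obtain ⟨u, hu⟩ := (UT.isNilpotent_of_mem_band (Ideal.mul_mem_left _ y hA)).isUnit_one_add
    refine ⟨(↑u⁻¹ : UT K n), ?_⟩
    have h : (↑u⁻¹ : UT K n) * (1 + y * A) = 1 := by rw [← hu]; exact u.inv_mul
    rw [Ideal.mem_bot, ← sub_eq_zero.2 h]
    noncomm_ring

/-- Factor `e_ij = e_{i,i+1} e_{i+1,j}`: each step along the row costs one factor from the radical.
-/
theorem UT.single_mem_jacobson_pow {r : ℕ} {i j : Fin n} (h : (i : ℕ) + r ≤ j) (c : K)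
    {A : UT K n} (hA : A.1 = Matrix.single i j c) : A ∈ Ring.jacobson (UT K n) ^ r := by
  induction r generalizing i c A with
  | zero => rw [Submodule.pow_zero, Ideal.one_eq_top]; trivial
  | succ r ih =>
    let k : Fin n := ⟨i + 1, by omega⟩
    have single_mem {a b : Fin n} (hab : a ≤ b) (d : K) : Matrix.single a b d ∈ UT K n := by
      rw [Matrix.mem_blockTriangularSubalgebra]
      intro p q hpq
      rw [Matrix.single_apply, if_neg]
      rintro ⟨rfl, rfl⟩
      exact absurd hab (not_le.2 hpq)
    let B : UT K n := ⟨Matrix.single i k 1, single_mem (by simp [k, Fin.le_def]) 1⟩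
    let C : UT K n := ⟨Matrix.single k j c, single_mem (by simp [k, Fin.le_def]; omega) c⟩
    have hBC : A = B * C := Subtype.ext (by simp [B, C, hA])
    rw [hBC, Ideal.IsTwoSided.pow_succ]
    refine Ideal.mul_mem_mul ?_ (ih (by simp [k]; omega) c rfl)
    rw [UT.jacobson_eq_band]
    intro p q hpq
    simp only [B]
    rw [Matrix.single_apply, if_neg]
    rintro ⟨rfl, rfl⟩
    simp [k] at hpq

theorem UT.jacobson_pow_eq_band (r : ℕ) : Ring.jacobson (UT K n) ^ r = UT.band K n r := by
  apply le_antisymm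
  · induction r with
    | zero => rw [UT.band_zero]; exact le_top
    | succ r ih =>
      rw [Submodule.pow_succ]
      exact Ideal.mul_le.2 fun A hA B hB =>
        UT.mul_mem_band (ih hA) (UT.jacobson_eq_band (K := K) (n := n) ▸ hB)
  · intro A hA
    have hsum : A = ∑ i, ∑ j, (⟨Matrix.single i j (A.1 i j), by
        rw [Matrix.mem_blockTriangularSubalgebra]
        intro p q hpq
        rw [Matrix.single_apply]
        split_ifs with h
        · obtain ⟨rfl, rfl⟩ := h
          exact A.2 hpq
        · rfl⟩ : UT K n) := by
      apply Subtype.ext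
      conv_lhs => rw [Matrix.matrix_eq_sum_single A.1]
      simp
    rw [hsum]
    refine Ideal.sum_mem _ fun i _ => Ideal.sum_mem _ fun j _ => ?_
    rcases lt_or_ge (j : ℕ) (i + r) with h | h
    · convert Ideal.zero_mem _
      simp [hA i j h]
    · exact UT.single_mem_jacobson_pow h _ rfl

theorem UT.commutator_mem_band (A B : UT K n) : A * B - B * A ∈ UT.band K n 1 := by
  intro i j h
  rcases lt_or_eq_of_le (show j ≤ i by rw [Fin.le_def]; omega) with h' | rfl
  · exact (A * B - B * A).2 h'
  · change UT.diagHom j (A * B - B * A) = 0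
    simp [mul_comm]

end Radical

/-! ### Commutative image and block matrices -/

section Lewin

open MvPolynomial

variable {K : Type*} [Field K] {X : Type*}

/-- The canonical map from the free algebra to the commutative polynomial ring. -/
noncomputable def FreeAlgebra.toMvPolynomial (K X : Type*) [Field K] :
    FreeAlgebra K X →ₐ[K] MvPolynomial X K :=
  FreeAlgebra.lift K (MvPolynomial.X)

theorem FreeAlgebra.eval_toMvPolynomial (b : X → K) (f : FreeAlgebra K X) :
    eval b (FreeAlgebra.toMvPolynomial K X f) = FreeAlgebra.lift K b f := by
  have : (aeval b).comp (FreeAlgebra.toMvPolynomial K X) = FreeAlgebra.lift K b := by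
    ext x; simp [FreeAlgebra.toMvPolynomial]
  rw [← this]; simp [aeval_eq_eval]

theorem FreeAlgebra.exists_section : ∃ s : MvPolynomial X K →ₗ[K] FreeAlgebra K X,
    s 1 = 1 ∧ ∀ p, FreeAlgebra.toMvPolynomial K X (s p) = p := by
  have hsurj : Function.Surjective (FreeAlgebra.toMvPolynomial K X) := by
    rw [← AlgHom.range_eq_top, eq_top_iff, ← MvPolynomial.adjoin_range_X, Algebra.adjoin_le_iff]
    rintro _ ⟨x, rfl⟩
    exact ⟨FreeAlgebra.ι K x, by simp [FreeAlgebra.toMvPolynomial]⟩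
  obtain ⟨s, hs⟩ := LinearMap.exists_rightInverse_of_surjective
    (FreeAlgebra.toMvPolynomial K X).toLinearMap (LinearMap.range_eq_top.2 hsurj)
  have hs' (p) : FreeAlgebra.toMvPolynomial K X (s p) = p := LinearMap.congr_fun hs p
  -- Any linear section, corrected on constant terms by `1 - s 1`, which has zero commutative image.
  refine ⟨s + (MvPolynomial.lcoeff K 0).smulRight (1 - s 1), ?_, fun p => ?_⟩
  · simp
  · simp [hs']

/-- The quotient by the commutator ideal is commutative, so the quotient map factors through the
polynomial ring. -/
theorem FreeAlgebra.mem_span_commutators_of_toMvPolynomial_eq_zero {f : FreeAlgebra K X}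
    (hf : FreeAlgebra.toMvPolynomial K X f = 0) :
    f ∈ TwoSidedIdeal.span {g : FreeAlgebra K X | ∃ a b : FreeAlgebra K X, g = ⁅a, b⁆} := by
  set I := TwoSidedIdeal.span {g : FreeAlgebra K X | ∃ a b : FreeAlgebra K X, g = ⁅a, b⁆}
  let _ : CommRing I.ringCon.Quotient :=
    { (inferInstance : Ring I.ringCon.Quotient) with
      mul_comm := by
        intro a b
        induction a, b using Quotient.inductionOn₂' with | _ a b
        refine (RingCon.eq I.ringCon).2 ?_
        rw [TwoSidedIdeal.rel_iff]
        exact TwoSidedIdeal.subset_span ⟨a, b, (Ring.lie_def a b).symm⟩ }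
  let q : FreeAlgebra K X →ₐ[K] I.ringCon.Quotient := I.ringCon.mkₐ K
  have h : (aeval (fun x => q (FreeAlgebra.ι K x))).comp (FreeAlgebra.toMvPolynomial K X) = q := by
    ext x; simp [FreeAlgebra.toMvPolynomial]
  have h2 : q f = 0 := by rw [← h]; simp [hf]
  exact (RingCon.eq I.ringCon).1 h2

/-- The block upper triangular matrix with diagonal blocks `b` and `a`, and first row `(b, c)`. -/
def Matrix.consBlock {R : Type*} [Zero R] {r : ℕ} (b : R) (c : Fin r → R)
    (a : Matrix (Fin r) (Fin r) R) : Matrix (Fin (r + 1)) (Fin (r + 1)) R :=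
  Matrix.of (Fin.cons (Fin.cons b c) fun i => Fin.cons 0 (a i))

theorem Matrix.consBlock_blockTriangular {R : Type*} [Zero R] {r : ℕ} (b : R) (c : Fin r → R)
    {a : Matrix (Fin r) (Fin r) R} (ha : a.BlockTriangular id) :
    (Matrix.consBlock b c a).BlockTriangular id := by
  intro i j
  refine Fin.cases ?_ (fun i => ?_) i
  · simp
  · refine Fin.cases ?_ (fun j => ?_) j
    · simp [Matrix.consBlock]
    · intro h
      simpa [Matrix.consBlock] using ha (Fin.succ_lt_succ_iff.1 h)

theorem Matrix.consBlock_mul {R : Type*} [CommRing R] {r : ℕ} (b b' : R) (c c' : Fin r → R)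
    (a a' : Matrix (Fin r) (Fin r) R) :
    Matrix.consBlock b c a * Matrix.consBlock b' c' a' =
      Matrix.consBlock (b * b') (b • c' + Matrix.vecMul c a') (a * a') := by
  ext i j
  refine Fin.cases ?_ (fun i => ?_) i <;> refine Fin.cases ?_ (fun j => ?_) j <;>
    simp [Matrix.consBlock, Matrix.mul_apply, Fin.sum_univ_succ, Matrix.vecMul, dotProduct]

theorem Matrix.consBlock_add {R : Type*} [CommRing R] {r : ℕ} (b b' : R) (c c' : Fin r → R)
    (a a' : Matrix (Fin r) (Fin r) R) :
    Matrix.consBlock b c a + Matrix.consBlock b' c' a' =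
      Matrix.consBlock (b + b') (c + c') (a + a') := by
  ext i j
  refine Fin.cases ?_ (fun i => ?_) i <;> refine Fin.cases ?_ (fun j => ?_) j <;>
    simp [Matrix.consBlock]

theorem Matrix.algebraMap_eq_consBlock {R : Type*} [CommRing R] {r : ℕ} (k : R) :
    algebraMap R (Matrix (Fin (r + 1)) (Fin (r + 1)) R) k =
      Matrix.consBlock k 0 (algebraMap R _ k) := by
  ext i j
  refine Fin.cases ?_ (fun i => ?_) i <;> refine Fin.cases ?_ (fun j => ?_) j <;>
    simp [Matrix.consBlock, Matrix.algebraMap_matrix_apply, Fin.succ_ne_zero,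
      (Fin.succ_ne_zero _).symm]

/-- The first row, off the diagonal, of a polynomial evaluated at block matrices. -/
noncomputable def FreeAlgebra.blockRow {r : ℕ} (b : X → K) (c : X → Fin r → K)
    (a : X → Matrix (Fin r) (Fin r) K) (f : FreeAlgebra K X) : Fin r → K :=
  fun j => FreeAlgebra.lift K (fun x => Matrix.consBlock (b x) (c x) (a x)) f 0 j.succ

theorem Matrix.consBlock_zero_succ {R : Type*} [Zero R] {r : ℕ} (b : R) (c : Fin r → R)
    (a : Matrix (Fin r) (Fin r) R) (j : Fin r) : Matrix.consBlock b c a 0 j.succ = c j := rfl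

theorem FreeAlgebra.lift_consBlock {r : ℕ} (b : X → K) (c : X → Fin r → K)
    (a : X → Matrix (Fin r) (Fin r) K) (f : FreeAlgebra K X) :
    FreeAlgebra.lift K (fun x => Matrix.consBlock (b x) (c x) (a x)) f =
      Matrix.consBlock (FreeAlgebra.lift K b f) (FreeAlgebra.blockRow b c a f)
        (FreeAlgebra.lift K a f) := by
  suffices h : ∃ v, FreeAlgebra.lift K (fun x => Matrix.consBlock (b x) (c x) (a x)) f =
      Matrix.consBlock (FreeAlgebra.lift K b f) v (FreeAlgebra.lift K a f) by
    obtain ⟨v, hv⟩ := h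
    have : FreeAlgebra.blockRow b c a f = v := by
      funext j; rw [FreeAlgebra.blockRow, hv, Matrix.consBlock_zero_succ]
    rw [hv, this]
  induction f using FreeAlgebra.induction with
  | grade0 k => exact ⟨0, by simpa using Matrix.algebraMap_eq_consBlock k⟩
  | grade1 x => exact ⟨c x, by simp⟩
  | mul f g hf hg =>
    obtain ⟨v, hv⟩ := hf
    obtain ⟨w, hw⟩ := hg
    exact ⟨_, by rw [map_mul, hv, hw, Matrix.consBlock_mul, map_mul, map_mul]⟩
  | add f g hf hg =>
    obtain ⟨v, hv⟩ := hf
    obtain ⟨w, hw⟩ := hg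
    exact ⟨_, by rw [map_add, hv, hw, Matrix.consBlock_add, map_add, map_add]⟩

section blockRow

variable {r : ℕ} (b : X → K) (c : X → Fin r → K) (a : X → Matrix (Fin r) (Fin r) K)

theorem FreeAlgebra.blockRow_add (f g : FreeAlgebra K X) :
    blockRow b c a (f + g) = blockRow b c a f + blockRow b c a g := by
  funext j; simp [blockRow]

theorem FreeAlgebra.blockRow_smul (k : K) (f : FreeAlgebra K X) :
    blockRow b c a (k • f) = k • blockRow b c a f := by
  funext j; simp [blockRow]

theorem FreeAlgebra.blockRow_one : blockRow b c a 1 = 0 := by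
  funext j; simp [blockRow, (Fin.succ_ne_zero _).symm]

theorem FreeAlgebra.blockRow_mul_ι (f : FreeAlgebra K X) (x : X) :
    blockRow b c a (f * ι K x) = lift K b f • c x + Matrix.vecMul (blockRow b c a f) (a x) := by
  funext j
  conv_lhs => rw [blockRow, map_mul, lift_consBlock, lift_ι_apply, Matrix.consBlock_mul,
    Matrix.consBlock_zero_succ]

end blockRow

/-- The elements `s(m) x - s(m x)` generate the commutator ideal as a right ideal. The coefficients
`u` do not depend on `b`, `c`, `a`, which lets these vary freely afterwards. -/
theorem FreeAlgebra.exists_expansion (s : MvPolynomial X K →ₗ[K] FreeAlgebra K X) (hs : s 1 = 1)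
    (r : ℕ) (f : FreeAlgebra K X) :
    ∃ u : X × (X →₀ ℕ) →₀ FreeAlgebra K X,
      f = s (FreeAlgebra.toMvPolynomial K X f) +
        u.sum (fun i v => (s (monomial i.2 1) * ι K i.1 -
          s (monomial i.2 1 * MvPolynomial.X i.1)) * v) ∧
      ∀ (b : X → K) (c : X → Fin r → K) (a : X → Matrix (Fin r) (Fin r) K),
        blockRow b c a f =
          u.sum fun i v => eval b (monomial i.2 1) • Matrix.vecMul (c i.1) (lift K a v) := by
  let E (x : X) (p : MvPolynomial X K) : FreeAlgebra K X := s p * ι K x - s (p * MvPolynomial.X x)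
  let Φ : (X × (X →₀ ℕ) →₀ FreeAlgebra K X) →ₗ[K] FreeAlgebra K X :=
    Finsupp.lsum K fun i => LinearMap.mulLeft K (E i.1 (monomial i.2 1))
  let Ψ (b : X → K) (c : X → Fin r → K) (a : X → Matrix (Fin r) (Fin r) K) :
      (X × (X →₀ ℕ) →₀ FreeAlgebra K X) →ₗ[K] (Fin r → K) :=
    Finsupp.lsum K fun i => eval b (monomial i.2 1) •
      (Matrix.vecMulBilin K K (c i.1)).comp (lift K a).toLinearMap
  -- Being expandable is preserved by right multiplication by `f`; start from `g = 1`, where `s 1 =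
  -- 1` gives `u = 0`.
  suffices h : ∀ g : FreeAlgebra K X,
      (∃ u, g = s (FreeAlgebra.toMvPolynomial K X g) + Φ u ∧
        ∀ b c a, blockRow b c a g = Ψ b c a u) →
      ∃ u, g * f = s (FreeAlgebra.toMvPolynomial K X (g * f)) + Φ u ∧
        ∀ b c a, blockRow b c a (g * f) = Ψ b c a u by
    have := h 1 ⟨0, by simp [hs], fun b c a => by simp [blockRow_one]⟩
    rw [one_mul] at this
    exact this
  have hE (x : X) (p : MvPolynomial X K) :
      ∃ u, Φ u = E x p ∧ ∀ b c a, Ψ b c a u = eval b p • c x := by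
    induction p using MvPolynomial.induction_on' with
    | monomial m k =>
      refine ⟨Finsupp.single (x, m) (algebraMap K _ k), ?_, fun b c a => ?_⟩
      · have : monomial m k = k • monomial m (1 : K) := by simp [smul_monomial]
        rw [this]
        simp [Φ, E, Algebra.algebraMap_eq_smul_one, smul_sub]
      · simp [Ψ, Algebra.algebraMap_eq_smul_one, eval_monomial, smul_smul,
          mul_comm]
    | add p q hp hq =>
      obtain ⟨u, hu, hu'⟩ := hp
      obtain ⟨v, hv, hv'⟩ := hq
      refine ⟨u + v, ?_, fun b c a => ?_⟩
      · rw [map_add, hu, hv]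
        simp only [E, map_add, add_mul]
        abel
      · rw [map_add, hu', hv', map_add, add_smul]
  induction f using FreeAlgebra.induction with
  | grade0 k =>
    rintro g ⟨u, hu, hu'⟩
    have : g * algebraMap K _ k = k • g := by
      rw [Algebra.algebraMap_eq_smul_one, mul_smul_comm, mul_one]
    rw [this]
    refine ⟨k • u, ?_, fun b c a => ?_⟩
    · conv_lhs => rw [hu]
      simp
    · rw [blockRow_smul, hu', map_smul]
  | grade1 x =>
    rintro g ⟨u, hu, hu'⟩
    obtain ⟨v, hv, hv'⟩ := hE x (toMvPolynomial K X g)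
    -- `g x = s(π g) x + Φ u x`, and `s(π g) x = E x (π g) + s(π g x)`, with `π` the commutative
    -- image.
    refine ⟨u.mapRange (· * ι K x) (zero_mul _) + v, ?_, fun b c a => ?_⟩
    · have : Φ (u.mapRange (· * ι K x) (zero_mul _)) = Φ u * ι K x := by
        simp only [Φ, Finsupp.lsum_apply]
        rw [Finsupp.sum_mapRange_index (by simp), Finsupp.sum_mul]
        simp [mul_assoc]
      rw [map_add, this, hv, map_mul]
      conv_lhs => rw [hu]
      simp [E, toMvPolynomial, add_mul]
      abel
    · have : Ψ b c a (u.mapRange (· * ι K x) (zero_mul _)) =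
          Matrix.vecMul (Ψ b c a u) (a x) := by
        simp only [Ψ, Finsupp.lsum_apply]
        rw [Finsupp.sum_mapRange_index (by simp), Finsupp.sum, Finsupp.sum,
          Matrix.sum_vecMul]
        simp [Matrix.smul_vecMul]
      rw [map_add, this, hv', blockRow_mul_ι, hu', eval_toMvPolynomial, add_comm]
  | mul f f' hf hf' =>
    intro g hg
    rw [← mul_assoc]
    exact hf' _ (hf _ hg)
  | add f f' hf hf' =>
    intro g hg
    obtain ⟨u, hu, hu'⟩ := hf g hg
    obtain ⟨v, hv, hv'⟩ := hf' g hg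
    refine ⟨u + v, ?_, fun b c a => ?_⟩
    · rw [mul_add, map_add, map_add, map_add]
      conv_lhs => rw [hu, hv]
      abel
    · rw [mul_add, blockRow_add, hu', hv', map_add]

end Lewin

/-! ### Products of commutators and identities of `UT_r` -/

section Commutators

variable (K : Type*) [Field K] (X : Type*)

/-- The two-sided ideal generated by all products of `r` commutators. -/
def FreeAlgebra.commutatorIdeal (r : ℕ) : TwoSidedIdeal (FreeAlgebra K X) :=
  TwoSidedIdeal.span {g | ∃ a b : Fin r → FreeAlgebra K X, g = (List.ofFn fun i => ⁅a i, b i⁆).prod}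

variable {K X}

theorem FreeAlgebra.commutatorIdeal_zero (f : FreeAlgebra K X) : f ∈ commutatorIdeal K X 0 := by
  rw [← mul_one f]
  exact TwoSidedIdeal.mul_mem_left _ _ _ (TwoSidedIdeal.subset_span ⟨0, 0, by simp⟩)

theorem FreeAlgebra.lie_mul_mem_commutatorIdeal {r : ℕ} {f : FreeAlgebra K X}
    (hf : f ∈ commutatorIdeal K X r) (a b : FreeAlgebra K X) :
    ⁅a, b⁆ * f ∈ commutatorIdeal K X (r + 1) := by
  induction hf using TwoSidedIdeal.span_induction generalizing a b with
  | mem g hg =>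
    obtain ⟨p, q, rfl⟩ := hg
    exact TwoSidedIdeal.subset_span ⟨Fin.cons a p, Fin.cons b q, by simp [List.ofFn_succ]⟩
  | zero => rw [mul_zero]; exact TwoSidedIdeal.zero_mem _
  | add g h _ _ hg hh => rw [mul_add]; exact TwoSidedIdeal.add_mem _ (hg a b) (hh a b)
  | neg g _ hg => rw [mul_neg]; exact TwoSidedIdeal.neg_mem _ (hg a b)
  | left_absorb z g _ hg =>
    -- Moving `z` to the left past a commutator costs only another commutator times `g`.
    have : ⁅a, b⁆ * (z * g) = z * (⁅a, b⁆ * g) + ⁅⁅a, b⁆, z⁆ * g := by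
      rw [Ring.lie_def ⁅a, b⁆ z]; noncomm_ring
    rw [this]
    exact TwoSidedIdeal.add_mem _ (TwoSidedIdeal.mul_mem_left _ _ _ (hg a b)) (hg _ _)
  | right_absorb z g _ hg =>
    rw [← mul_assoc]
    exact TwoSidedIdeal.mul_mem_right _ _ _ (hg a b)

theorem FreeAlgebra.mul_mem_commutatorIdeal {r : ℕ} {e f : FreeAlgebra K X}
    (he : e ∈ TwoSidedIdeal.span {g : FreeAlgebra K X | ∃ a b : FreeAlgebra K X, g = ⁅a, b⁆})
    (hf : f ∈ commutatorIdeal K X r) : e * f ∈ commutatorIdeal K X (r + 1) := by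
  induction he using TwoSidedIdeal.span_induction generalizing f with
  | mem g hg =>
    obtain ⟨p, q, rfl⟩ := hg
    exact lie_mul_mem_commutatorIdeal hf p q
  | zero => rw [zero_mul]; exact TwoSidedIdeal.zero_mem _
  | add g h _ _ hg hh => rw [add_mul]; exact TwoSidedIdeal.add_mem _ (hg hf) (hh hf)
  | neg g _ hg => rw [neg_mul]; exact TwoSidedIdeal.neg_mem _ (hg hf)
  | left_absorb z g _ hg =>
    rw [mul_assoc]
    exact TwoSidedIdeal.mul_mem_left _ _ _ (hg hf)
  | right_absorb z g _ hg =>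
    rw [mul_assoc]
    exact hg (TwoSidedIdeal.mul_mem_left _ _ _ hf)

theorem UT.coe_lift {n : ℕ} (a : X → UT K n) (f : FreeAlgebra K X) :
    (FreeAlgebra.lift K a f : UT K n).1 = FreeAlgebra.lift K (fun x => (a x).1) f := by
  have : (UT K n).val.comp (FreeAlgebra.lift K a) = FreeAlgebra.lift K (fun x => (a x).1) := by
    ext x; simp
  rw [← this]; rfl

theorem mem_polyIdentities_UT {r : ℕ} {f : FreeAlgebra K X} :
    f ∈ polyIdentities K X (UT K r) ↔
      ∀ a : X → Matrix (Fin r) (Fin r) K, (∀ x, (a x).BlockTriangular id) →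
        FreeAlgebra.lift K a f = 0 := by
  constructor
  · intro h a ha
    rw [← UT.coe_lift (fun x => ⟨a x, ha x⟩), h]
    rfl
  · intro h a
    exact Subtype.ext (by rw [UT.coe_lift]; exact h _ fun x => (a x).2)

open MvPolynomial in
theorem polyIdentities_UT_le_commutatorIdeal [Infinite K] {r : ℕ} {f : FreeAlgebra K X}
    (hf : f ∈ polyIdentities K X (UT K r)) : f ∈ FreeAlgebra.commutatorIdeal K X r := by
  induction r generalizing f with
  | zero => exact FreeAlgebra.commutatorIdeal_zero f
  | succ r ih =>
    rw [mem_polyIdentities_UT] at hf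
    obtain ⟨s, hs, hs'⟩ := FreeAlgebra.exists_section (K := K) (X := X)
    obtain ⟨u, hu, hu'⟩ := FreeAlgebra.exists_expansion s hs r f
    have hblock (b : X → K) (c : X → Fin r → K) {a : X → Matrix (Fin r) (Fin r) K}
        (ha : ∀ x, (a x).BlockTriangular id) :
        Matrix.consBlock (FreeAlgebra.lift K b f) (FreeAlgebra.blockRow b c a f)
          (FreeAlgebra.lift K a f) = 0 := by
      rw [← FreeAlgebra.lift_consBlock]
      exact hf _ fun x => Matrix.consBlock_blockTriangular _ _ (ha x)
    have hπ : FreeAlgebra.toMvPolynomial K X f = 0 := by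
      refine MvPolynomial.funext fun b => ?_
      rw [FreeAlgebra.eval_toMvPolynomial, map_zero]
      exact congrFun (congrFun (hblock b 0 (a := 0) fun x => by simp) 0) 0
    have hmem (x : X) (m : X →₀ ℕ) : u (x, m) ∈ polyIdentities K X (UT K r) := by
      classical
      rw [mem_polyIdentities_UT]
      intro a ha
      ext k j
      -- Collect the `(k, j)` entries of the `v(a)` belonging to `x` as coefficients of one
      -- polynomial in `b`. It vanishes at every point, since its values are first-row entries of
      -- `f` once `c` is the `k`-th unit vector at `x` and zero elsewhere.
      let Q : MvPolynomial X K := u.sum fun i v =>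
        if i.1 = x then monomial i.2 (FreeAlgebra.lift K a v k j) else 0
      have hQ : Q = 0 := by
        refine MvPolynomial.funext fun b => ?_
        let c : X → Fin r → K := fun y => if y = x then Pi.single k 1 else 0
        have h0 : FreeAlgebra.blockRow b c a f j = 0 :=
          congrFun (congrFun (hblock b c ha) 0) j.succ
        rw [hu', Finsupp.sum, Finset.sum_apply] at h0
        rw [map_zero, ← h0]
        simp only [Q, Finsupp.sum]
        rw [map_sum]
        refine Finset.sum_congr rfl fun i _ => ?_
        simp only [c]
        split_ifs with h
        · simp [eval_monomial, mul_comm]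
        · simp
      have hc : coeff m Q = FreeAlgebra.lift K a (u (x, m)) k j := by
        simp only [Q, Finsupp.sum]
        rw [coeff_sum, Finset.sum_eq_single (x, m)]
        · simp
        · rintro ⟨y, l⟩ _ hne
          split_ifs with h
          · rw [coeff_monomial, if_neg]
            rintro rfl
            exact hne (by simp at h; rw [h])
          · simp
        · intro h
          rw [Finsupp.notMem_support_iff.1 h]
          simp
      rw [← hc, hQ]
      simp
    rw [hu, hπ, map_zero, zero_add]
    refine sum_mem fun i _ => FreeAlgebra.mul_mem_commutatorIdeal ?_ (ih (hmem i.1 i.2))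
    apply FreeAlgebra.mem_span_commutators_of_toMvPolynomial_eq_zero
    rw [map_sub, map_mul, hs', hs', FreeAlgebra.toMvPolynomial, FreeAlgebra.lift_ι_apply, sub_self]

/-! ### The remaining inclusions and T-ideals -/

theorem prod_lie_mem_imageInRadicalPow {n r : ℕ} (p q : Fin r → FreeAlgebra K X) :
    (List.ofFn fun i => ⁅p i, q i⁆).prod ∈ imageInRadicalPow K X n r := by
  rintro _ ⟨a, rfl⟩
  rw [UT.jacobson_pow_eq_band]
  simp only [map_list_prod, List.map_ofFn]
  have (m : ℕ) (g : Fin m → UT K n) (hg : ∀ i, g i ∈ UT.band K n 1) :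
      (List.ofFn g).prod ∈ UT.band K n m := by
    induction m with
    | zero => rw [UT.band_zero]; trivial
    | succ m ih =>
      rw [List.ofFn_succ, List.prod_cons]
      have h := UT.mul_mem_band (hg 0) (ih _ fun i => hg i.succ)
      rwa [add_comm 1 m] at h
  refine this r _ fun i => ?_
  simp only [Function.comp_apply, Ring.lie_def, map_sub, map_mul]
  exact UT.commutator_mem_band _ _

theorem isTIdeal_imageInRadicalPow (n r : ℕ) : IsTIdeal (imageInRadicalPow K X n r) := by
  have hmem (f : FreeAlgebra K X) : f ∈ imageInRadicalPow K X n r ↔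
      ∀ a : X → UT K n, FreeAlgebra.lift K a f ∈ Ring.jacobson (UT K n) ^ r :=
    Set.range_subset_iff
  refine ⟨⟨TwoSidedIdeal.mk' (imageInRadicalPow K X n r) ?_ ?_ ?_ ?_ ?_,
    TwoSidedIdeal.coe_mk' _ _ _ _ _ _⟩, ?_⟩
  · simp [hmem]
  · intro f g hf hg
    rw [hmem] at *
    intro a
    rw [map_add]
    exact Ideal.add_mem _ (hf a) (hg a)
  · intro f hf
    rw [hmem] at *
    intro a
    rw [map_neg]
    exact neg_mem (hf a)
  · intro f g hg
    rw [hmem] at *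
    intro a
    rw [map_mul]
    exact Ideal.mul_mem_left _ _ (hg a)
  · intro f g hf
    rw [hmem] at *
    intro a
    rw [map_mul]
    exact Ideal.mul_mem_right _ _ (hf a)
  · intro φ f hf
    rw [hmem] at *
    intro a
    have : (FreeAlgebra.lift K a).comp φ =
        FreeAlgebra.lift K fun x => FreeAlgebra.lift K a (φ (FreeAlgebra.ι K x)) := by
      ext x; simp
    have h2 := congrArg (fun ψ => ψ f) this
    simp only [AlgHom.comp_apply] at h2
    rw [h2]
    exact hf _

theorem commutatorIdeal_subset_imageInRadicalPow (n r : ℕ) :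
    (FreeAlgebra.commutatorIdeal K X r : Set (FreeAlgebra K X)) ⊆ imageInRadicalPow K X n r := by
  obtain ⟨⟨I, hI⟩, -⟩ := isTIdeal_imageInRadicalPow (K := K) (X := X) n r
  rw [← hI]
  refine TwoSidedIdeal.span_le.2 ?_
  rintro _ ⟨a, b, rfl⟩
  rw [hI]
  exact prod_lie_mem_imageInRadicalPow a b

theorem imageInRadicalPow_subset_polyIdentities {n r : ℕ} (hrn : r ≤ n) :
    imageInRadicalPow K X n r ⊆ polyIdentities K X (UT K r) := by
  intro f hf
  rw [mem_polyIdentities_UT]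
  intro a ha
  let A : X → UT K n := fun x =>
    ⟨Matrix.of fun i j => if h : (i : ℕ) < r ∧ (j : ℕ) < r then a x ⟨i, h.1⟩ ⟨j, h.2⟩ else 0, by
      rw [Matrix.mem_blockTriangularSubalgebra]
      intro i j hij
      rw [Matrix.of_apply]
      split_ifs with h
      · exact ha x hij
      · rfl⟩
  -- Padding by zeros is not unital, but taking the corner is multiplicative on triangular matrices:
  -- entries below the corner are zero.
  have key (g : FreeAlgebra K X) (i j : Fin r) :
      FreeAlgebra.lift K a g i j =
        (FreeAlgebra.lift K A g : UT K n).1 (Fin.castLE hrn i) (Fin.castLE hrn j) := by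
    induction g using FreeAlgebra.induction generalizing i j with
    | grade0 k =>
      simp [Matrix.algebraMap_matrix_apply]
    | grade1 x => simp [A]
    | add g h hg hh => simp [hg, hh]
    | mul g h hg hh =>
      simp only [map_mul, MulMemClass.coe_mul, Matrix.mul_apply, hg, hh]
      rw [← Finset.sum_subset (Finset.subset_univ (Finset.univ.map (Fin.castLEEmb hrn)))]
      · simp
      · intro k _ hk
        have hkr : r ≤ k := by
          by_contra hlt
          exact hk (Finset.mem_map.2 ⟨⟨k, by omega⟩, by simp, by ext; simp⟩)
        have h0 : (FreeAlgebra.lift K A h : UT K n).1 k (Fin.castLE hrn j) = 0 :=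
          (FreeAlgebra.lift K A h).2 (show Fin.castLE hrn j < k by
            rw [Fin.lt_def, Fin.val_castLE]; omega)
        exact mul_eq_zero_of_right _ h0
  ext i j
  rw [key]
  have := hf ⟨A, rfl⟩
  rw [UT.jacobson_pow_eq_band] at this
  exact this _ _ (by simp; omega)

theorem IsTIdeal.commutatorIdeal_subset {T : Set (FreeAlgebra K X)} (hT : IsTIdeal T) {r : ℕ}
    {x : Fin (2 * r) → X} (hx : Function.Injective x) (h : commutatorProduct K r x ∈ T) :
    (FreeAlgebra.commutatorIdeal K X r : Set (FreeAlgebra K X)) ⊆ T := by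
  obtain ⟨⟨I, rfl⟩, hφ⟩ := hT
  refine TwoSidedIdeal.span_le.2 ?_
  rintro _ ⟨a, b, rfl⟩
  -- One substitution sends the variables of the `i`-th commutator to `a i` and `b i`; it is well
  -- defined because they are distinct, and other variables go to `0`.
  let v : Fin (2 * r) → FreeAlgebra K X := fun i =>
    if (i : ℕ) % 2 = 0 then a ⟨i / 2, by omega⟩ else b ⟨i / 2, by omega⟩
  convert hφ (FreeAlgebra.lift K (Function.extend x v 0)) _ h using 1
  rw [commutatorProduct, map_list_prod, List.map_ofFn]
  congr 2
  funext i
  simp only [Function.comp_apply, Ring.lie_def, map_sub, map_mul, FreeAlgebra.lift_ι_apply,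
    hx.extend_apply]
  have h1 : (2 * (i : ℕ) + 1) / 2 = i := by omega
  have h2 : (2 * (i : ℕ) + 1) % 2 = 1 := by omega
  simp [v, h1, h2]

end Commutators

theorem proposition5p2 {K : Type*} [Field K] [CharZero K] {X : Type*} (n r : ℕ) :
    IsTIdeal (imageInRadicalPow K X n r) ∧
      (r ≤ n →
        imageInRadicalPow K X n r = polyIdentities K X (UT K r) ∧
          ∀ x : Fin (2 * r) → X, Function.Injective x →
            IsTIdealGeneratedBy (imageInRadicalPow K X n r) {commutatorProduct K r x}) := by
  have : Infinite K := CharZero.infinite K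
  refine ⟨isTIdeal_imageInRadicalPow n r, fun hrn => ⟨?_, fun x hx => ?_⟩⟩
  · refine (imageInRadicalPow_subset_polyIdentities hrn).antisymm fun f hf => ?_
    exact commutatorIdeal_subset_imageInRadicalPow n r (polyIdentities_UT_le_commutatorIdeal hf)
  · refine ⟨⟨isTIdeal_imageInRadicalPow n r,
      Set.singleton_subset_iff.2 (prod_lie_mem_imageInRadicalPow _ _)⟩, ?_⟩
    rintro T ⟨hT, hxT⟩ f hf
    exact hT.commutatorIdeal_subset hx (hxT rfl)
      (polyIdentities_UT_le_commutatorIdeal (imageInRadicalPow_subset_polyIdentities hrn hf))
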